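/- Let $A$ be an Artin algebra (an algebra over a commutative artinian ring $R$, finitely generated as an $R$-module), let $\mathrm{mod}\,A$ be the category of finitely generated right $A$-modules, and for $M\in\mathrm{mod}\,A$ let $\Omega M$ be the kernel of a projective cover of $M$. Let $K_0$ be the abelian group generated by the symbols $[M]$, $M\in\mathrm{mod}\,A$, modulo the relations $[M]-[M']-[M'']$ whenever $M\cong M'\oplus M''$ and $[P]$ whenever $P$ is projective, and let $\bar\Omega:K_0\to K_0$ be the endomorphism with $\bar\Omega[M]=[\Omega M]$. Write $\langle \mathrm{add}\,M\rangle\subseteq K_0$ for the subgroup generated by the classes of the indecomposable direct summands of $M$, and for a class $\mathcal D\subseteq\mathrm{mod}\,A$ write $\langle\mathcal D\rangle$ for the subgroup generated by all $[D]$, $D\in\mathcal D$. For an endomorphism $L$ of an abelian group $G$ and a subgroup $X\subseteq G$ let $\eta_L(X)$ be the least $k\ge 0$ such that $L$ is injective on $L^m(X)$ for all $m\ge k$ (and $\infty$ if there is none). Put $\phi(M)=\eta_{\bar\Omega}(\langle\mathrm{add}\,M\rangle)$ and $\phi\dim(\mathcal D)=\sup\{\phi(D):D\in\mathcal D\}$.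 If $\Omega(\mathcal D)\subseteq\mathcal D$, let $\bar\Omega_{\mathcal D}$ be the endomorphism of $K_0/\langle\mathcal D\rangle$ induced by $\bar\Omega$ and put $$\Phi_{[\mathcal D]}(M)=\eta_{\bar\Omega_{\mathcal D}}\big((\langle\mathrm{add}\,M\rangle+\langle\mathcal D\rangle)/\langle\mathcal D\rangle\big).$$ Call $\mathcal D$ a $0$-Igusa-Todorov subcategory with preimages if 1. $\mathcal D=\mathrm{add}\,\mathcal D$, i.e. $\mathcal D$ consists exactly of the modules isomorphic to finite (possibly empty) direct sums of direct summands of modules in $\mathcal D$; 2. $\Omega(\mathcal D)\subseteq\mathcal D$; 3. $\phi\dim(\mathcal D)=0$; 4. for every $D\in\mathcal D$ there are $D_1,D_2\in\mathcal D$ and an integer $m\ge 1$ with $\bar\Omega([D_1]-[D_2])=m[D]$. Theorem. Let $A$ be an Artin algebra and $\mathcal D\subseteq\mathrm{mod}\,A$ a $0$-Igusa-Todorov subcategory with preimages. Then for every $M\in\mathrm{mod}\,A$ there is $D\in\mathcal D$ such that $\phi(M\oplus D)=\Phi_{[\mathcal D]}(M)$. -/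

import Mathlib

universe u

namespace IgusaTodorov

/-- `A` is an Artin algebra: for some commutative artinian ring `R` it is an `R`-algebra that is
finitely generated as an `R`-module. (`R` may be replaced by its image in `A`, so taking it in the
universe of `A` is no restriction.) -/
class IsArtinAlgebra (A : Type u) [Ring A] : Prop where
  exists_base : ∃ (R : Type u) (_ : CommRing R) (_ : Algebra R A),
    IsArtinianRing R ∧ Module.Finite R A

/-- The ring of an Artin algebra is right artinian: the right `A`-modules are the left modules over
the (left) artinian ring `Aᵐᵒᵖ`. -/
instance instIsArtinianRingOp (A : Type u) [Ring A] [IsArtinAlgebra A] :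
    IsArtinianRing Aᵐᵒᵖ := by
  obtain ⟨R, _, _, _, _⟩ := IsArtinAlgebra.exists_base (A := A)
  have : Module.Finite R Aᵐᵒᵖ := Module.Finite.equiv (MulOpposite.opLinearEquiv R (M := A))
  have : IsArtinian R Aᵐᵒᵖ := inferInstance
  exact isArtinian_of_tower R this

section Modules

variable {Λ : Type u} [Ring Λ]

/-- `N` is isomorphic to a direct summand of `M`. -/
def IsSummand (N M : FGModuleCat.{u} Λ) : Prop :=
  ∃ N' : FGModuleCat.{u} Λ, Nonempty (M ≃ₗ[Λ] (N × N'))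

/-- `M` is indecomposable: nonzero, and not the direct sum of two nonzero modules. -/
def IsIndecomposable (M : FGModuleCat.{u} Λ) : Prop :=
  Nontrivial M ∧ ∀ N N' : FGModuleCat.{u} Λ,
    Nonempty (M ≃ₗ[Λ] (N × N')) → Subsingleton N ∨ Subsingleton N'

/-- `add 𝒟`: all modules isomorphic to a finite (possibly empty) direct sum of direct summands of
modules in `𝒟`. -/
def addClosure (𝒟 : Set (FGModuleCat.{u} Λ)) : Set (FGModuleCat.{u} Λ) :=
  {X | ∃ (n : ℕ) (Y : Fin n → FGModuleCat.{u} Λ),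
    (∀ i, ∃ Z ∈ 𝒟, IsSummand (Y i) Z) ∧ Nonempty (X ≃ₗ[Λ] (∀ i, Y i))}

/-- `f : P → M` is a projective cover: `P` is projective, `f` is onto and `ker f` is superfluous
(small) in `P`. -/
structure IsProjectiveCover {P M : Type u} [AddCommGroup P] [Module Λ P] [AddCommGroup M]
    [Module Λ M] (f : P →ₗ[Λ] M) : Prop where
  projective : Module.Projective Λ P
  surjective : Function.Surjective f
  superfluous : ∀ N : Submodule Λ P, N ⊔ LinearMap.ker f = ⊤ → N = ⊤

/-- Finitely generated modules over an artinian ring have projective covers. -/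
theorem exists_projectiveCover [IsArtinianRing Λ] (M : FGModuleCat.{u} Λ) :
    ∃ (P : FGModuleCat.{u} Λ) (f : P →ₗ[Λ] M), IsProjectiveCover f := by
  obtain ⟨n, f₀, hf₀⟩ := Module.Finite.exists_fin' Λ M
  let S : Set (Submodule Λ (Fin n → Λ)) :=
    {N | Module.Projective Λ N ∧ Function.Surjective (f₀ ∘ₗ N.subtype)}
  have hS : S.Nonempty := by
    refine ⟨⊤, Module.Projective.of_equiv (Submodule.topEquiv (R := Λ) (M := Fin n → Λ)).symm, ?_⟩
    intro m
    obtain ⟨x, hx⟩ := hf₀ m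
    exact ⟨⟨x, trivial⟩, hx⟩
  obtain ⟨N, ⟨hNp, hNs⟩, hmin⟩ := WellFounded.has_min
    (wellFounded_lt : WellFounded ((· < ·) : Submodule Λ (Fin n → Λ) → _ → Prop)) S hS
  set f := f₀ ∘ₗ N.subtype with hf
  refine ⟨FGModuleCat.of Λ N, f, hNp, hNs, ?_⟩
  change ∀ K : Submodule Λ N, K ⊔ LinearMap.ker f = ⊤ → K = ⊤
  intro K hK
  have hKs : Function.Surjective (f ∘ₗ K.subtype) := by
    intro m
    obtain ⟨x, rfl⟩ := hNs m
    have hx : x ∈ K ⊔ LinearMap.ker f := hK ▸ Submodule.mem_top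
    obtain ⟨a, ha, b, hb, rfl⟩ := Submodule.mem_sup.1 hx
    refine ⟨⟨a, ha⟩, ?_⟩
    have : f b = 0 := hb
    simp [map_add, this]
  obtain ⟨g, hg⟩ := Module.projective_lifting_property (f ∘ₗ K.subtype) f hKs
  let e : Module.End Λ N := K.subtype ∘ₗ g
  have he : ∀ x, f (e x) = f x := fun x => LinearMap.congr_fun hg x
  have hek : ∀ (k : ℕ) x, f ((e ^ k) x) = f x := by
    intro k
    induction k with
    | zero => intro x; rfl
    | succ k ih => intro x; rw [pow_succ', Module.End.mul_apply, he, ih]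
  obtain ⟨k, hk⟩ := Filter.eventually_atTop.1 e.eventually_isCompl_ker_pow_range_pow
  have hc := hk (k + 1) (Nat.le_succ k)
  set I := LinearMap.range (e ^ (k + 1)) with hI
  have hIproj : Module.Projective Λ I :=
    Module.Projective.of_split I.subtype (I.projectionOnto _ hc.symm)
      (LinearMap.ext fun x => Submodule.projectionOnto_apply_left hc.symm x)
  have hmem : I.map N.subtype ∈ S := by
    refine ⟨Module.Projective.of_equiv
      (Submodule.equivMapOfInjective N.subtype N.injective_subtype I), ?_⟩
    intro m
    obtain ⟨x, rfl⟩ := hNs m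
    refine ⟨⟨((e ^ (k + 1)) x : N), Submodule.mem_map_of_mem ⟨x, rfl⟩⟩, ?_⟩
    exact hek (k + 1) x
  have hIle : I.map N.subtype ≤ N := Submodule.map_subtype_le N I
  have hIN : I.map N.subtype = N :=
    (hIle.lt_or_eq).resolve_left (hmin _ hmem)
  rw [eq_top_iff]
  rintro ⟨x, hx⟩ -
  rw [← hIN] at hx
  obtain ⟨y, ⟨z, rfl⟩, hy⟩ := hx
  have hxy : (⟨x, by rw [← hIN]; exact ⟨_, ⟨z, rfl⟩, hy⟩⟩ : N) = (e ^ (k + 1)) z :=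
    Subtype.ext hy.symm
  rw [hxy, pow_succ', Module.End.mul_apply]
  exact (g ((e ^ k) z)).2

/-- The module `P(M)` of a projective cover of `M`. -/
noncomputable def projCover [IsArtinianRing Λ] (M : FGModuleCat.{u} Λ) : FGModuleCat.{u} Λ :=
  (exists_projectiveCover M).choose

/-- The projection `P(M) → M` of a projective cover of `M`. -/
noncomputable def projCoverMap [IsArtinianRing Λ] (M : FGModuleCat.{u} Λ) :
    projCover M →ₗ[Λ] M :=
  (exists_projectiveCover M).choose_spec.choose

theorem projCoverMap_spec [IsArtinianRing Λ] (M : FGModuleCat.{u} Λ) :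
    IsProjectiveCover (projCoverMap M) :=
  (exists_projectiveCover M).choose_spec.choose_spec

/-- The syzygy `Ω M`: the kernel of a projective cover of `M`. -/
noncomputable def syzygy [IsArtinianRing Λ] (M : FGModuleCat.{u} Λ) : FGModuleCat.{u} Λ :=
  FGModuleCat.of Λ (LinearMap.ker (projCoverMap M))

/-- Schanuel's lemma. -/
theorem schanuel {P Q M : Type u} [AddCommGroup P] [Module Λ P] [AddCommGroup Q] [Module Λ Q]
    [AddCommGroup M] [Module Λ M] [Module.Projective Λ P] [Module.Projective Λ Q]
    (f : P →ₗ[Λ] M) (g : Q →ₗ[Λ] M) (hf : Function.Surjective f) (hg : Function.Surjective g) :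
    Nonempty ((LinearMap.ker f × Q) ≃ₗ[Λ] (LinearMap.ker g × P)) := by
  obtain ⟨s, hs⟩ := Module.projective_lifting_property g f hg
  obtain ⟨t, ht⟩ := Module.projective_lifting_property f g hf
  have hs' : ∀ x, g (s x) = f x := LinearMap.congr_fun hs
  have ht' : ∀ x, f (t x) = g x := LinearMap.congr_fun ht
  let p : (LinearMap.ker f × Q) →ₗ[Λ] P :=
    (LinearMap.ker f).subtype ∘ₗ LinearMap.fst Λ _ _ + t ∘ₗ LinearMap.snd Λ _ _
  let q : (LinearMap.ker g × P) →ₗ[Λ] Q :=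
    (LinearMap.ker g).subtype ∘ₗ LinearMap.fst Λ _ _ + s ∘ₗ LinearMap.snd Λ _ _
  let a : (LinearMap.ker f × Q) →ₗ[Λ] LinearMap.ker g :=
    (LinearMap.snd Λ _ _ - s ∘ₗ p).codRestrict _ (by
      rintro ⟨⟨x, hx⟩, y⟩
      have hx' : f x = 0 := hx
      simp [p, hs', ht', hx'])
  let b : (LinearMap.ker g × P) →ₗ[Λ] LinearMap.ker f :=
    (LinearMap.snd Λ _ _ - t ∘ₗ q).codRestrict _ (by
      rintro ⟨⟨x, hx⟩, y⟩
      have hx' : g x = 0 := hx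
      simp [q, hs', ht', hx'])
  refine ⟨LinearEquiv.ofLinearMap (a.prod p) (b.prod q) ?_ ?_⟩
  · apply LinearMap.ext
    rintro ⟨⟨x, hx⟩, y⟩
    ext <;> simp [a, b, p, q]
  · apply LinearMap.ext
    rintro ⟨⟨x, hx⟩, y⟩
    ext <;> simp [a, b, p, q]

end Modules

section GrothendieckGroup

variable (Λ : Type u) [Ring Λ]

/-- The relations `[M] - [M'] - [M'']` for `M ≅ M' ⊕ M''`, and `[P]` for `P` projective. -/
def kRelations : Set (FreeAbelianGroup (FGModuleCat.{u} Λ)) :=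
  {x | ∃ M M' M'' : FGModuleCat.{u} Λ, Nonempty (M ≃ₗ[Λ] (M' × M'')) ∧
      x = FreeAbelianGroup.of M - FreeAbelianGroup.of M' - FreeAbelianGroup.of M''} ∪
  {x | ∃ P : FGModuleCat.{u} Λ, Module.Projective Λ P ∧ x = FreeAbelianGroup.of P}

/-- The group `K₀`: generated by the symbols `[M]` of finitely generated modules, modulo
`kRelations`. -/
abbrev KZero : Type (u + 1) :=
  FreeAbelianGroup (FGModuleCat.{u} Λ) ⧸ AddSubgroup.closure (kRelations Λ)

variable {Λ}

/-- The class `[M]` in `K₀`. -/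
def cls (M : FGModuleCat.{u} Λ) : KZero Λ :=
  QuotientAddGroup.mk (FreeAbelianGroup.of M)

theorem cls_prod {M M' M'' : FGModuleCat.{u} Λ} (e : M ≃ₗ[Λ] (M' × M'')) :
    cls M = cls M' + cls M'' := by
  have h : ((FreeAbelianGroup.of M - FreeAbelianGroup.of M' - FreeAbelianGroup.of M'' :
      FreeAbelianGroup (FGModuleCat.{u} Λ)) : KZero Λ) = 0 :=
    (QuotientAddGroup.eq_zero_iff _).2
      (AddSubgroup.subset_closure (Or.inl ⟨M, M', M'', ⟨e⟩, rfl⟩))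
  have h' : cls M - cls M' - cls M'' = 0 := h
  rw [sub_sub, sub_eq_zero] at h'
  exact h'

theorem cls_projective (P : FGModuleCat.{u} Λ) (hP : Module.Projective Λ P) : cls P = 0 :=
  (QuotientAddGroup.eq_zero_iff _).2 (AddSubgroup.subset_closure (Or.inr ⟨P, hP, rfl⟩))

/-- `[Ω M]` can be computed from any surjection of a finitely generated projective onto `M`. -/
theorem cls_syzygy [IsArtinianRing Λ] {P M : FGModuleCat.{u} Λ} (hP : Module.Projective Λ P)
    (f : P →ₗ[Λ] M) (hf : Function.Surjective f) :
    cls (syzygy M) = cls (FGModuleCat.of Λ (LinearMap.ker f)) := by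
  have hQ := (projCoverMap_spec M).projective
  obtain ⟨e⟩ := schanuel (projCoverMap M) f (projCoverMap_spec M).surjective hf
  have h₁ : cls (FGModuleCat.of Λ (LinearMap.ker f × projCover M)) =
      cls (FGModuleCat.of Λ (LinearMap.ker f)) + cls (projCover M) :=
    cls_prod (LinearEquiv.refl Λ _)
  have h₂ : cls (FGModuleCat.of Λ (LinearMap.ker f × projCover M)) =
      cls (syzygy M) + cls P := cls_prod (M' := syzygy M) (M'' := P) e.symm
  rw [cls_projective _ hP, add_zero] at h₂
  rw [cls_projective _ hQ, add_zero] at h₁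
  rw [← h₁, ← h₂]

theorem cls_syzygy_prod [IsArtinianRing Λ] {M M' M'' : FGModuleCat.{u} Λ}
    (e : M ≃ₗ[Λ] (M' × M'')) : cls (syzygy M) = cls (syzygy M') + cls (syzygy M'') := by
  have h' := (projCoverMap_spec M').projective
  have h'' := (projCoverMap_spec M'').projective
  let g : FGModuleCat.of Λ (projCover M' × projCover M'') →ₗ[Λ] M :=
    e.symm.toLinearMap ∘ₗ (projCoverMap M').prodMap (projCoverMap M'')
  have hg : Function.Surjective g := e.symm.surjective.comp
    ((projCoverMap_spec M').surjective.prodMap (projCoverMap_spec M'').surjective)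
  have hker : LinearMap.ker g =
      (LinearMap.ker (projCoverMap M')).prod (LinearMap.ker (projCoverMap M'')) := by
    rw [← LinearMap.ker_prodMap]
    exact LinearMap.ker_comp_of_ker_eq_bot _ (LinearEquiv.ker _)
  rw [cls_syzygy (inferInstanceAs (Module.Projective Λ (projCover M' × projCover M''))) g hg]
  let e' : (LinearMap.ker (projCoverMap M')).prod (LinearMap.ker (projCoverMap M'')) ≃ₗ[Λ]
      (LinearMap.ker (projCoverMap M') × LinearMap.ker (projCoverMap M'')) :=
    { toFun := fun x => (⟨x.1.1, x.2.1⟩, ⟨x.1.2, x.2.2⟩)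
      invFun := fun x => ⟨(x.1.1, x.2.1), ⟨x.1.2, x.2.2⟩⟩
      map_add' := fun _ _ => rfl
      map_smul' := fun _ _ => rfl
      left_inv := fun _ => rfl
      right_inv := fun _ => rfl }
  exact cls_prod (M' := syzygy M') (M'' := syzygy M'') ((LinearEquiv.ofEq _ _ hker).trans e')

theorem cls_syzygy_projective [IsArtinianRing Λ] (P : FGModuleCat.{u} Λ)
    (hP : Module.Projective Λ P) : cls (syzygy P) = 0 := by
  rw [cls_syzygy hP LinearMap.id Function.surjective_id]
  refine cls_projective _ ?_
  have : Subsingleton (LinearMap.ker (LinearMap.id : P →ₗ[Λ] P)) := by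
    rw [LinearMap.ker_id]; infer_instance
  exact Module.Projective.of_free

/-- The endomorphism `Ω̄` of `K₀` induced by `Ω`: `Ω̄ [M] = [Ω M]`. -/
noncomputable def omegaBar (Λ : Type u) [Ring Λ] [IsArtinianRing Λ] : AddMonoid.End (KZero Λ) :=
  QuotientAddGroup.lift _
    (FreeAbelianGroup.lift fun M : FGModuleCat.{u} Λ => cls (syzygy M)) (by
      rw [AddSubgroup.closure_le]
      rintro x (⟨M, M', M'', ⟨e⟩, rfl⟩ | ⟨P, hP, rfl⟩)
      · simp [cls_syzygy_prod e]
      · simp [cls_syzygy_projective P hP])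

theorem omegaBar_cls [IsArtinianRing Λ] (M : FGModuleCat.{u} Λ) :
    omegaBar Λ (cls M) = cls (syzygy M) :=
  FreeAbelianGroup.lift_apply_of _ _

/-- `⟨𝒟⟩`: the subgroup of `K₀` generated by the classes of the modules in `𝒟`. -/
def classSpan (𝒟 : Set (FGModuleCat.{u} Λ)) : AddSubgroup (KZero Λ) :=
  AddSubgroup.closure (cls '' 𝒟)

/-- `⟨add M⟩`: the subgroup of `K₀` generated by the classes of the indecomposable direct summands
of `M`. -/
def addSpan (M : FGModuleCat.{u} Λ) : AddSubgroup (KZero Λ) :=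
  classSpan {N | IsIndecomposable N ∧ IsSummand N M}

end GrothendieckGroup

section Functions

/-- `η_L(X)`: the least `k` such that for all `m ≥ k` the endomorphism `L` is injective on
`L^m(X)`, i.e. restricts to an isomorphism `L^m(X) → L^(m+1)(X)`; it is `⊤` if there is no
such `k`. -/
noncomputable def eta {G : Type*} [AddCommGroup G] (L : AddMonoid.End G) (X : AddSubgroup G) :
    ℕ∞ :=
  ⨅ k ∈ {k : ℕ | ∀ m ≥ k, Set.InjOn L ((L ^ m) '' (X : Set G))}, (k : ℕ∞)

variable {Λ : Type u} [Ring Λ] [IsArtinianRing Λ]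

/-- The Igusa-Todorov function `φ`. -/
noncomputable def phi (M : FGModuleCat.{u} Λ) : ℕ∞ :=
  eta (omegaBar Λ) (addSpan M)

/-- The `φ`-dimension of a class of modules. -/
noncomputable def phiDim (𝒟 : Set (FGModuleCat.{u} Λ)) : ℕ∞ :=
  ⨆ M ∈ 𝒟, phi M

/-- `𝒟` is invariant by `Ω`. -/
def SyzygyInvariant (𝒟 : Set (FGModuleCat.{u} Λ)) : Prop :=
  ∀ X ∈ 𝒟, syzygy X ∈ 𝒟

theorem classSpan_le_comap {𝒟 : Set (FGModuleCat.{u} Λ)} (h : SyzygyInvariant 𝒟) :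
    classSpan 𝒟 ≤ (classSpan 𝒟).comap (omegaBar Λ) := by
  rw [classSpan, AddSubgroup.closure_le]
  rintro _ ⟨X, hX, rfl⟩
  change omegaBar Λ (cls X) ∈ AddSubgroup.closure _
  rw [omegaBar_cls]
  exact AddSubgroup.subset_closure ⟨_, h X hX, rfl⟩

/-- The endomorphism `Ω̄_𝒟` of `K₀ / ⟨𝒟⟩` induced by `Ω̄`. -/
noncomputable def omegaBarRel (𝒟 : Set (FGModuleCat.{u} Λ)) (h : SyzygyInvariant 𝒟) :
    AddMonoid.End (KZero Λ ⧸ classSpan 𝒟) :=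
  QuotientAddGroup.map _ _ (omegaBar Λ) (classSpan_le_comap h)

/-- The relative Igusa-Todorov function `Φ_[𝒟]`: `η` of `Ω̄_𝒟` on the image of `⟨add M⟩` in
`K₀ / ⟨𝒟⟩`. -/
noncomputable def relPhi (𝒟 : Set (FGModuleCat.{u} Λ)) (h : SyzygyInvariant 𝒟)
    (M : FGModuleCat.{u} Λ) : ℕ∞ :=
  eta (omegaBarRel 𝒟 h) ((addSpan M).map (QuotientAddGroup.mk' (classSpan 𝒟)))

/-- `0`-Igusa-Todorov subcategories. -/
structure IsZeroITSubcategory (𝒟 : Set (FGModuleCat.{u} Λ)) : Prop where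
  addClosure_eq : addClosure 𝒟 = 𝒟
  syzygyInvariant : SyzygyInvariant 𝒟
  phiDim_eq_zero : phiDim 𝒟 = 0

/-- `0`-Igusa-Todorov subcategories with preimages. -/
structure IsZeroITSubcategoryWithPreimages (𝒟 : Set (FGModuleCat.{u} Λ)) : Prop
    extends IsZeroITSubcategory 𝒟 where
  preimages : ∀ D ∈ 𝒟, ∃ D₁ ∈ 𝒟, ∃ D₂ ∈ 𝒟, ∃ m : ℕ, 0 < m ∧
    omegaBar Λ (cls D₁ - cls D₂) = m • cls D

end Functions

end IgusaTodorov

/-!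
Let `H = ⟨𝒟⟩ ⊆ K₀`, `X = ⟨add M⟩` and `L = Ω̄`. The assumptions on `𝒟` become statements about `H`:

* `L` is injective on `H`, because every element of `H` lies in `⟨add D⟩` for one `D ∈ 𝒟` and
  `φ(D) = 0` (`IsZeroITSubcategory.eq_zero_of_omegaBar_eq_zero`);
* every element of `H` has a positive multiple in `L(H)`
  (`IsZeroITSubcategoryWithPreimages.exists_omegaBar_eq_nsmul`);
* `K₀ / H` is torsion free (`mem_of_nsmul_mem_classSpan`).

The number `η` of `X` modulo `H` is a natural number `n`, since `X` is finitely generated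
(`exists_eta_map_mk_eq_natCast`). For every `D ∈ 𝒟` the group `⟨add (M ⊕ D)⟩` lies in `X + H`. If
`L ^ (m + 1)` kills `x + d` with `x ∈ X`, `d ∈ H` and `m ≥ n`, then `L ^ (m + 1) x ∈ H`, hence
`L ^ m x ∈ H`, and the injectivity of `L` on `H` yields `L ^ m (x + d) = 0`; so `φ(M ⊕ D) ≤ n`
(`eta_le_of_eta_map_mk_le`). Conversely, if `n > 0` there is `x ∈ X` with `L ^ n x ∈ H` and
`L ^ (n - 1) x ∉ H`. Some positive multiple of `L ^ n x` is `L ^ n h` with `h ∈ H`, say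
`L ^ n (m x - h) = 0`, whereas `L ^ (n - 1) (m x - h) ≠ 0` because `K₀ / H` is torsion free. Any `D`
with `h ∈ ⟨add D⟩` then gives `φ(M ⊕ D) ≥ n` (`exists_forall_le_eta_of_le_eta_map_mk`).

The rest is Krull–Schmidt theory. The exchange property (`IsIndecomposable.isSummand_or`) gives
`⟨add (M ⊕ D)⟩ ⊆ X + H`; that an indecomposable direct summand occurs in every decomposition
(`HasDecomposition.exists_cons`) makes `X` finitely generated; and the uniqueness of decompositions
(`HasDecomposition.unique`) lets one count, on `K₀`, the summands whose classes are not in `H`,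
which embeds `K₀ / H` into a free abelian group. All of this rests on the locality of the
endomorphism ring of an indecomposable module (`IsIndecomposable.isLocalRing_end`) and on the
cancellation of modules with local endomorphism rings (`nonempty_equiv_of_prod_equiv_prod`).
-/

namespace IgusaTodorov


/-! ### Direct summands and local endomorphism rings -/

section Summands

variable {Λ : Type u} [Ring Λ]

theorem exists_equiv_prod_ker {N M : Type*} [AddCommGroup N] [Module Λ N] [AddCommGroup M]
    [Module Λ M] (s : N →ₗ[Λ] M) (r : M →ₗ[Λ] N) (h : r ∘ₗ s = LinearMap.id) :
    Nonempty (M ≃ₗ[Λ] (N × LinearMap.ker r)) := by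
  have h' : ∀ x, r (s x) = x := LinearMap.congr_fun h
  let k : M →ₗ[Λ] LinearMap.ker r :=
    (LinearMap.id - s ∘ₗ r).codRestrict _ (by intro x; simp [h'])
  refine ⟨LinearEquiv.ofLinearMap (r.prod k) (s.coprod (LinearMap.ker r).subtype) ?_ ?_⟩
  · apply LinearMap.ext
    rintro ⟨x, y, hy⟩
    have hy' : r y = 0 := hy
    ext <;> simp [k, h', hy']
  · ext x
    simp [k]

theorem isSummand_of_isUnit_comp [IsNoetherianRing Λ] {N M : FGModuleCat.{u} Λ}
    (s : N →ₗ[Λ] M) (r : M →ₗ[Λ] N) (h : IsUnit (r ∘ₗ s : Module.End Λ N)) :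
    IsSummand N M := by
  obtain ⟨v, -, hv⟩ := isUnit_iff_exists.1 h
  obtain ⟨e⟩ := exists_equiv_prod_ker s (v ∘ₗ r) hv
  exact ⟨FGModuleCat.of Λ (LinearMap.ker (v ∘ₗ r)), ⟨e⟩⟩

theorem IsSummand.refl (M : FGModuleCat.{u} Λ) : IsSummand M M :=
  ⟨FGModuleCat.of Λ PUnit, ⟨LinearEquiv.prodUnique.symm⟩⟩

theorem IsSummand.trans {N M X : FGModuleCat.{u} Λ} (h : IsSummand N M) (h' : IsSummand M X) :
    IsSummand N X := by
  obtain ⟨B, ⟨e⟩⟩ := h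
  obtain ⟨C, ⟨f⟩⟩ := h'
  exact ⟨FGModuleCat.of Λ (B × C),
    ⟨f ≪≫ₗ (e.prodCongr (.refl Λ C)) ≪≫ₗ LinearEquiv.prodAssoc Λ N B C⟩⟩

theorem isSummand_left {M P Q : FGModuleCat.{u} Λ} (e : M ≃ₗ[Λ] (P × Q)) : IsSummand P M :=
  ⟨Q, ⟨e⟩⟩

theorem isSummand_right {M P Q : FGModuleCat.{u} Λ} (e : M ≃ₗ[Λ] (P × Q)) : IsSummand Q M :=
  ⟨P, ⟨e ≪≫ₗ LinearEquiv.prodComm Λ P Q⟩⟩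

/-- Fitting's lemma: an endomorphism of an indecomposable module of finite length is invertible or
nilpotent, so that the endomorphism ring is local. -/
theorem IsIndecomposable.isLocalRing_end [IsArtinianRing Λ] {N : FGModuleCat.{u} Λ}
    (hN : IsIndecomposable N) : IsLocalRing (Module.End Λ N) := by
  have := hN.1
  refine IsLocalRing.of_isUnit_or_isUnit_one_sub_self fun f => ?_
  obtain ⟨k, hk⟩ := Filter.eventually_atTop.1 f.eventually_isCompl_ker_pow_range_pow
  have hc := hk (k + 1) (Nat.le_succ k)
  rcases hN.2 (FGModuleCat.of Λ (LinearMap.ker (f ^ (k + 1))))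
    (FGModuleCat.of Λ (LinearMap.range (f ^ (k + 1))))
    ⟨(Submodule.prodEquivOfIsCompl _ _ hc).symm⟩ with h | h
  · left
    have h0 : LinearMap.ker (f ^ (k + 1)) = ⊥ := Submodule.subsingleton_iff_eq_bot.1 h
    have h1 : LinearMap.range (f ^ (k + 1)) = ⊤ := by
      have := hc.sup_eq_top
      rwa [h0, bot_sup_eq] at this
    have hu : IsUnit (f ^ (k + 1)) :=
      (Module.End.isUnit_iff _).2 ⟨LinearMap.ker_eq_bot.1 h0, LinearMap.range_eq_top.1 h1⟩
    exact (isUnit_pow_iff (Nat.succ_ne_zero k)).1 hu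
  · right
    have h1 : LinearMap.range (f ^ (k + 1)) = ⊥ := Submodule.subsingleton_iff_eq_bot.1 h
    exact IsNilpotent.isUnit_one_sub ⟨k + 1, LinearMap.range_eq_bot.1 h1⟩

/-- The exchange property of indecomposable modules. -/
theorem IsIndecomposable.isSummand_or [IsArtinianRing Λ] {N M P Q : FGModuleCat.{u} Λ}
    (hN : IsIndecomposable N) (h : IsSummand N M) (e : M ≃ₗ[Λ] (P × Q)) :
    IsSummand N P ∨ IsSummand N Q := by
  have := hN.isLocalRing_end
  obtain ⟨B, ⟨f⟩⟩ := h
  let i : N →ₗ[Λ] (P × Q) := (f.symm ≪≫ₗ e).toLinearMap ∘ₗ LinearMap.inl Λ N B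
  let p : (P × Q) →ₗ[Λ] N := LinearMap.fst Λ N B ∘ₗ (e.symm ≪≫ₗ f).toLinearMap
  have hsum : ((p ∘ₗ LinearMap.inl Λ P Q) ∘ₗ (LinearMap.fst Λ P Q ∘ₗ i) : Module.End Λ N) +
      (p ∘ₗ LinearMap.inr Λ P Q) ∘ₗ (LinearMap.snd Λ P Q ∘ₗ i) = 1 := by
    ext x
    have h1 : ∀ y : P × Q, p (y.1, 0) + p (0, y.2) = p y := fun y => by
      rw [← map_add]; simp
    have h2 : p (i x) = x := by simp [p, i]
    exact (h1 (i x)).trans h2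
  rcases IsLocalRing.isUnit_or_isUnit_of_add_one hsum with hu | hu
  · exact Or.inl (isSummand_of_isUnit_comp _ _ hu)
  · exact Or.inr (isSummand_of_isUnit_comp _ _ hu)

theorem IsIndecomposable.nonempty_equiv_of_isSummand {N N' : FGModuleCat.{u} Λ}
    (hN : IsIndecomposable N) (hN' : IsIndecomposable N') (h : IsSummand N N') :
    Nonempty (N ≃ₗ[Λ] N') := by
  obtain ⟨B, ⟨f⟩⟩ := h
  rcases hN'.2 N B ⟨f⟩ with h | h
  · have := hN.1
    exact (not_subsingleton N h).elim
  · have : Unique B := uniqueOfSubsingleton 0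
    exact ⟨LinearEquiv.prodUnique.symm ≪≫ₗ f.symm⟩

theorem isUnit_of_mul_eq_one_of_isLocalRing {S : Type*} [Ring S] [IsLocalRing S] {a c : S}
    (h : c * a = 1) : IsUnit a := by
  rcases IsLocalRing.isUnit_or_isUnit_of_add_one (add_sub_cancel (a * c) 1) with hu | hu
  · obtain ⟨v, hv, -⟩ := isUnit_iff_exists.1 hu
    rw [mul_assoc] at hv
    exact isUnit_iff_exists.2 ⟨c, by rw [left_inv_eq_right_inv h hv, hv], h⟩
  · -- `1 - a * c` annihilates `a`.
    have h0 : (1 - a * c) * a = 0 := by rw [sub_mul, mul_assoc, h, one_mul, mul_one, sub_self]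
    rw [hu.mul_right_eq_zero] at h0
    rw [h0, mul_zero] at h
    exact (zero_ne_one h).elim

/-- An isomorphism `N × A ≃ N × B` whose component `N → N` is invertible gives `A ≃ B`. -/
theorem nonempty_equiv_of_isUnit_component {N A B : Type*} [AddCommGroup N] [Module Λ N]
    [AddCommGroup A] [Module Λ A] [AddCommGroup B] [Module Λ B] (f : (N × A) ≃ₗ[Λ] (N × B))
    (h : IsUnit (LinearMap.fst Λ N B ∘ₗ f.toLinearMap ∘ₗ LinearMap.inl Λ N A : Module.End Λ N)) :
    Nonempty (A ≃ₗ[Λ] B) := by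
  obtain ⟨v, hv1, hv2⟩ := isUnit_iff_exists.1 h
  have hv1' : ∀ x, (f (v x, 0)).1 = x := LinearMap.congr_fun hv1
  have hv2' : ∀ x, v (f (x, 0)).1 = x := LinearMap.congr_fun hv2
  -- `a` goes to the `B`-coordinate of the image of the only point `(n, a)` mapped into `0 × B`.
  let α : A →ₗ[Λ] (N × A) :=
    (-(v ∘ₗ LinearMap.fst Λ N B ∘ₗ f.toLinearMap ∘ₗ LinearMap.inr Λ N A)).prod LinearMap.id
  have hsplit : ∀ (x : N) (a : A), f (x, a) = f (x, 0) + f (0, a) := fun x a => by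
    rw [← map_add]; simp
  have hα : ∀ a, (f (α a)).1 = 0 := fun a => by
    have : α a = (-(v (f (0, a)).1), a) := rfl
    rw [this, hsplit, ← map_neg v, Prod.fst_add, hv1']
    simp
  have hα' : ∀ x a, (f (x, a)).1 = 0 → (x, a) = α a := fun x a hx => by
    have h1 : x = -(v (f (0, a)).1) := by
      rw [hsplit, Prod.fst_add] at hx
      rw [← map_neg, ← eq_neg_of_add_eq_zero_left hx, hv2']
    exact Prod.ext h1 rfl
  refine ⟨LinearEquiv.ofLinearMap (LinearMap.snd Λ N B ∘ₗ f.toLinearMap ∘ₗ α)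
    (LinearMap.snd Λ N A ∘ₗ f.symm.toLinearMap ∘ₗ LinearMap.inr Λ N B) ?_ ?_⟩
  · ext b
    have h1 := hα' (f.symm (0, b)).1 (f.symm (0, b)).2 (by simp)
    change (f (α (f.symm (0, b)).2)).2 = b
    rw [← h1]
    simp
  · ext a
    change (f.symm (0, (f (α a)).2)).2 = a
    have h1 : ((0 : N), (f (α a)).2) = f (α a) := Prod.ext (hα a).symm rfl
    rw [h1, LinearEquiv.symm_apply_apply]
    rfl

/-- Modules with a local endomorphism ring cancel from direct sums. -/
theorem nonempty_equiv_of_prod_equiv_prod {N A B : Type*} [AddCommGroup N] [Module Λ N]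
    [AddCommGroup A] [Module Λ A] [AddCommGroup B] [Module Λ B] [IsLocalRing (Module.End Λ N)]
    (f : (N × A) ≃ₗ[Λ] (N × B)) : Nonempty (A ≃ₗ[Λ] B) := by
  let f₁ : Module.End Λ N := LinearMap.fst Λ N B ∘ₗ f.toLinearMap ∘ₗ LinearMap.inl Λ N A
  let f₂ : N →ₗ[Λ] B := LinearMap.snd Λ N B ∘ₗ f.toLinearMap ∘ₗ LinearMap.inl Λ N A
  let g₁ : Module.End Λ N := LinearMap.fst Λ N A ∘ₗ f.symm.toLinearMap ∘ₗ LinearMap.inl Λ N B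
  let g₂ : B →ₗ[Λ] N := LinearMap.fst Λ N A ∘ₗ f.symm.toLinearMap ∘ₗ LinearMap.inr Λ N B
  have hsum : g₁ * f₁ + (g₂ ∘ₗ f₂ : Module.End Λ N) = 1 := by
    ext x
    have h1 : ∀ y : N × B, (f.symm (y.1, 0)).1 + (f.symm (0, y.2)).1 = (f.symm y).1 := fun y => by
      rw [← Prod.fst_add, ← map_add]; simp
    have h2 := h1 (f (x, 0))
    rw [LinearEquiv.symm_apply_apply] at h2
    exact h2
  by_cases hu : IsUnit f₁
  · exact nonempty_equiv_of_isUnit_component f hu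
  -- Otherwise `g₂ ∘ f₂` is a unit and `f₁` is not, so `f₁ + g₂ ∘ f₂` is a unit; it is the component
  -- of the isomorphism obtained from `f` by adding `g₂ b` to the coordinate in `N` of `(n, b)`.
  let w : (N × B) ≃ₗ[Λ] (N × B) := LinearEquiv.ofLinearMap
    ((LinearMap.fst Λ N B + g₂ ∘ₗ LinearMap.snd Λ N B).prod (LinearMap.snd Λ N B))
    ((LinearMap.fst Λ N B - g₂ ∘ₗ LinearMap.snd Λ N B).prod (LinearMap.snd Λ N B))
    (by ext <;> simp) (by ext <;> simp)
  refine nonempty_equiv_of_isUnit_component (f ≪≫ₗ w) ?_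
  change IsUnit (f₁ + g₂ ∘ₗ f₂)
  have hgf : IsUnit (g₂ ∘ₗ f₂ : Module.End Λ N) := by
    refine (IsLocalRing.isUnit_or_isUnit_of_add_one hsum).resolve_left fun h => hu ?_
    obtain ⟨v, -, hv⟩ := isUnit_iff_exists.1 h
    exact isUnit_of_mul_eq_one_of_isLocalRing (c := v * g₁) (by rw [mul_assoc, hv])
  rw [← add_neg_cancel_comm f₁ (g₂ ∘ₗ f₂ : Module.End Λ N)] at hgf
  exact (IsLocalRing.isUnit_or_isUnit_of_isUnit_add hgf).resolve_right fun h =>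
    hu (by simpa using h)

end Summands


/-! ### Decompositions into indecomposable modules -/

section Decomposition

/-- Isomorphism of finitely generated modules. -/
def isoSetoid (Λ : Type u) [Ring Λ] : Setoid (FGModuleCat.{u} Λ) where
  r M N := Nonempty (M ≃ₗ[Λ] N)
  iseqv := ⟨fun M => ⟨.refl Λ M⟩, fun ⟨e⟩ => ⟨e.symm⟩, fun ⟨e⟩ ⟨f⟩ => ⟨e ≪≫ₗ f⟩⟩

/-- Isomorphism classes of finitely generated modules. -/
abbrev IsoClass (Λ : Type u) [Ring Λ] : Type (u + 1) :=
  Quotient (isoSetoid Λ)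

variable {Λ : Type u} [Ring Λ]

/-- The isomorphism class of a module. -/
def isoClass (M : FGModuleCat.{u} Λ) : IsoClass Λ :=
  Quotient.mk (isoSetoid Λ) M

theorem isoClass_eq_iff {M N : FGModuleCat.{u} Λ} :
    isoClass M = isoClass N ↔ Nonempty (M ≃ₗ[Λ] N) :=
  Quotient.eq (r := isoSetoid Λ)

/-- `HasDecomposition M s`: the module `M` is a direct sum of indecomposable modules whose
isomorphism classes, with multiplicities, form the multiset `s`. -/
inductive HasDecomposition : FGModuleCat.{u} Λ → Multiset (IsoClass Λ) → Prop
  | zero (M : FGModuleCat.{u} Λ) : Subsingleton M → HasDecomposition M 0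
  | cons (M N M' : FGModuleCat.{u} Λ) (s : Multiset (IsoClass Λ)) : IsIndecomposable N →
      Nonempty (M ≃ₗ[Λ] (N × M')) → HasDecomposition M' s → HasDecomposition M (isoClass N ::ₘ s)

theorem HasDecomposition.congr {M M' : FGModuleCat.{u} Λ} {s : Multiset (IsoClass Λ)}
    (h : HasDecomposition M s) (e : M ≃ₗ[Λ] M') : HasDecomposition M' s := by
  cases h with
  | zero _ hM => exact .zero _ e.symm.toEquiv.subsingleton
  | cons _ N X s hN hf h => exact .cons _ N X s hN (hf.map (e.symm ≪≫ₗ ·)) h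

theorem HasDecomposition.prod {P Q : FGModuleCat.{u} Λ} {s t : Multiset (IsoClass Λ)}
    (hP : HasDecomposition P s) (hQ : HasDecomposition Q t) :
    ∀ {M : FGModuleCat.{u} Λ}, (M ≃ₗ[Λ] (P × Q)) → HasDecomposition M (s + t) := by
  induction hP with
  | zero P hP =>
    intro M e
    have : Unique P := uniqueOfSubsingleton 0
    let e' : M ≃ₗ[Λ] Q := e ≪≫ₗ LinearEquiv.uniqueProd
    rw [zero_add]
    exact hQ.congr e'.symm
  | cons P N P' s hN hf h ih =>
    intro M e
    obtain ⟨f⟩ := hf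
    rw [Multiset.cons_add]
    exact .cons _ N (FGModuleCat.of Λ (P' × Q)) _ hN
      ⟨e ≪≫ₗ f.prodCongr (.refl Λ Q) ≪≫ₗ LinearEquiv.prodAssoc Λ N P' Q⟩ (ih (.refl Λ _))

theorem HasDecomposition.exists_of_mem {M : FGModuleCat.{u} Λ} {s : Multiset (IsoClass Λ)}
    (h : HasDecomposition M s) {c : IsoClass Λ} (hc : c ∈ s) :
    ∃ N, IsIndecomposable N ∧ IsSummand N M ∧ isoClass N = c := by
  induction h with
  | zero => simp at hc
  | cons M N M' s hN hf h ih =>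
    obtain ⟨f⟩ := hf
    rcases Multiset.mem_cons.1 hc with rfl | hc
    · exact ⟨N, hN, isSummand_left f, rfl⟩
    · obtain ⟨X, hX, hs, hXc⟩ := ih hc
      exact ⟨X, hX, hs.trans (isSummand_right f), hXc⟩

variable [IsArtinianRing Λ]

theorem exists_hasDecomposition (M : FGModuleCat.{u} Λ) : ∃ s, HasDecomposition M s := by
  induction hn : Module.length Λ M using WellFoundedLT.induction generalizing M with
  | _ n ih =>
    subst hn
    by_cases hM : Subsingleton M
    · exact ⟨0, .zero M hM⟩
    rw [not_subsingleton_iff_nontrivial] at hM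
    by_cases hI : IsIndecomposable M
    · exact ⟨_, .cons M M (FGModuleCat.of Λ PUnit) 0 hI ⟨LinearEquiv.prodUnique.symm⟩
        (.zero _ (inferInstanceAs (Subsingleton PUnit)))⟩
    simp only [IsIndecomposable, hM, true_and, not_forall, not_or,
      not_subsingleton_iff_nontrivial] at hI
    obtain ⟨P, Q, ⟨e⟩, hP, hQ⟩ := hI
    have hlen : Module.length Λ M = Module.length Λ P + Module.length Λ Q := by
      rw [e.length_eq, Module.length_prod]
    obtain ⟨s, hs⟩ := ih (Module.length Λ P) (by
      rw [hlen]
      simpa using ENat.add_lt_add_of_le_of_lt (Module.length_ne_top (R := Λ) (M := P)) le_rfl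
        (Module.length_pos (R := Λ) (M := Q))) P rfl
    obtain ⟨t, ht⟩ := ih (Module.length Λ Q) (by
      rw [hlen, add_comm]
      simpa using ENat.add_lt_add_of_le_of_lt (Module.length_ne_top (R := Λ) (M := Q)) le_rfl
        (Module.length_pos (R := Λ) (M := P))) Q rfl
    exact ⟨s + t, hs.prod ht e⟩

/-- An indecomposable direct summand can be removed from every decomposition. -/
theorem HasDecomposition.exists_cons {M N B : FGModuleCat.{u} Λ} {s : Multiset (IsoClass Λ)}
    (h : HasDecomposition M s) (hN : IsIndecomposable N) (e : M ≃ₗ[Λ] (N × B)) :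
    ∃ t, s = isoClass N ::ₘ t ∧ HasDecomposition B t := by
  have := hN.isLocalRing_end
  induction h generalizing B with
  | zero M hM =>
    have := hN.1
    have hNB : Subsingleton (N × B) := e.symm.toEquiv.subsingleton
    exact (not_subsingleton N (LinearMap.inl_injective (R := Λ) (M₂ := B)).subsingleton).elim
  | cons M N' M' s hN' hf h ih =>
    obtain ⟨f⟩ := hf
    by_cases hiso : Nonempty (N ≃ₗ[Λ] N')
    · obtain ⟨g⟩ := hiso
      obtain ⟨k⟩ := nonempty_equiv_of_prod_equiv_prod
        (g.prodCongr (.refl Λ M') ≪≫ₗ f.symm ≪≫ₗ e)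
      exact ⟨s, by rw [isoClass_eq_iff.2 ⟨g⟩], h.congr k⟩
    · obtain ⟨C, ⟨g⟩⟩ := (hN.isSummand_or (isSummand_left e) f).resolve_left fun hs =>
        hiso (hN.nonempty_equiv_of_isSummand hN' hs)
      obtain ⟨t, rfl, ht⟩ := ih g
      obtain ⟨k⟩ := nonempty_equiv_of_prod_equiv_prod (N := N) (A := B) (B := N' × C)
        (e.symm ≪≫ₗ f ≪≫ₗ (LinearEquiv.refl Λ N').prodCongr g ≪≫ₗ
          (LinearEquiv.prodAssoc Λ N' N C).symm ≪≫ₗ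
          (LinearEquiv.prodComm Λ N' N).prodCongr (.refl Λ C) ≪≫ₗ LinearEquiv.prodAssoc Λ N N' C)
      exact ⟨isoClass N' ::ₘ t, Multiset.cons_swap _ _ _, .cons _ N' C t hN' ⟨k⟩ ht⟩

/-- The Krull–Schmidt theorem. -/
theorem HasDecomposition.unique {M : FGModuleCat.{u} Λ} {s t : Multiset (IsoClass Λ)}
    (hs : HasDecomposition M s) (ht : HasDecomposition M t) : s = t := by
  induction hs generalizing t with
  | zero M hM =>
    cases ht with
    | zero => rfl
    | cons _ N M' t hN hf _ =>
      obtain ⟨f⟩ := hf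
      obtain ⟨t, h, -⟩ := (HasDecomposition.zero M hM).exists_cons hN f
      exact (Multiset.cons_ne_zero h.symm).elim
  | cons M N M' s hN hf _ ih =>
    obtain ⟨f⟩ := hf
    obtain ⟨t, rfl, h⟩ := ht.exists_cons hN f
    rw [ih h]

/-- The multiset of the isomorphism classes of the indecomposable direct summands of a module. -/
noncomputable def decomposition (M : FGModuleCat.{u} Λ) : Multiset (IsoClass Λ) :=
  (exists_hasDecomposition M).choose

theorem hasDecomposition_decomposition (M : FGModuleCat.{u} Λ) :
    HasDecomposition M (decomposition M) :=
  (exists_hasDecomposition M).choose_spec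

theorem decomposition_prod {M P Q : FGModuleCat.{u} Λ} (e : M ≃ₗ[Λ] (P × Q)) :
    decomposition M = decomposition P + decomposition Q :=
  (hasDecomposition_decomposition M).unique
    ((hasDecomposition_decomposition P).prod (hasDecomposition_decomposition Q) e)

theorem isoClass_mem_decomposition {M N : FGModuleCat.{u} Λ} (hN : IsIndecomposable N)
    (h : IsSummand N M) : isoClass N ∈ decomposition M := by
  obtain ⟨B, ⟨e⟩⟩ := h
  obtain ⟨t, ht, -⟩ := (hasDecomposition_decomposition M).exists_cons hN e
  rw [ht]
  exact Multiset.mem_cons_self _ _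

end Decomposition


/-! ### The function `η` relative to an invariant subgroup -/

section Eta

variable {G : Type*} [AddCommGroup G]

theorem pow_succ_apply_eq (L : AddMonoid.End G) (m : ℕ) (x : G) :
    (L ^ (m + 1)) x = L ((L ^ m) x) := by
  rw [pow_succ']
  rfl

theorem eta_le_natCast_iff (L : AddMonoid.End G) (X : AddSubgroup G) (k : ℕ) :
    eta L X ≤ k ↔ ∀ m : ℕ, k ≤ m → ∀ x ∈ X, (L ^ (m + 1)) x = 0 → (L ^ m) x = 0 := by
  have hinj : ∀ m : ℕ, Set.InjOn L ((L ^ m) '' (X : Set G)) ↔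
      ∀ x ∈ X, (L ^ (m + 1)) x = 0 → (L ^ m) x = 0 := by
    intro m
    constructor
    · intro h x hx hx0
      refine h ⟨x, hx, rfl⟩ ⟨0, X.zero_mem, map_zero _⟩ ?_
      rw [← pow_succ_apply_eq, hx0, map_zero]
    · rintro h _ ⟨x, hx, rfl⟩ _ ⟨y, hy, rfl⟩ hxy
      rw [← sub_eq_zero, ← map_sub]
      refine h _ (X.sub_mem hx hy) ?_
      rw [pow_succ_apply_eq, map_sub, map_sub, hxy, sub_self]
  constructor
  · intro h
    by_contra hk
    refine absurd h (not_le.2 (lt_of_lt_of_le (ENat.natCast_lt_natCast.2 k.lt_succ_self) ?_))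
    refine le_iInf₂ fun j hj => ENat.natCast_le_natCast.2 ?_
    by_contra hjk
    exact hk fun m hm => (hinj m).1 (hj m (by omega))
  · intro h
    exact iInf₂_le k fun m hm => (hinj m).2 (h m hm)

variable {L : AddMonoid.End G} {H : AddSubgroup G}

/-- The endomorphism of `G ⧸ H` induced by an endomorphism that maps `H` into itself. -/
def quotientEnd (hLH : H ≤ H.comap L) : AddMonoid.End (G ⧸ H) :=
  QuotientAddGroup.map H H L hLH

theorem pow_apply_mem (hLH : H ≤ H.comap L) (m : ℕ) {x : G} (hx : x ∈ H) : (L ^ m) x ∈ H := by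
  induction m with
  | zero => exact hx
  | succ m ih => rw [pow_succ_apply_eq]; exact hLH ih

theorem map_pow_mk (hLH : H ≤ H.comap L) (m : ℕ) (x : G) :
    (quotientEnd hLH ^ m) (x : G ⧸ H) =
      (((L ^ m) x : G) : G ⧸ H) := by
  induction m with
  | zero => rfl
  | succ m ih => rw [pow_succ_apply_eq, ih, pow_succ_apply_eq]; rfl

theorem eta_map_mk_le_natCast_iff (hLH : H ≤ H.comap L) (X : AddSubgroup G) (k : ℕ) :
    eta (quotientEnd hLH) (X.map (QuotientAddGroup.mk' H)) ≤ k ↔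
      ∀ m : ℕ, k ≤ m → ∀ x ∈ X, (L ^ (m + 1)) x ∈ H → (L ^ m) x ∈ H := by
  rw [eta_le_natCast_iff]
  refine forall₂_congr fun m _ => ?_
  constructor
  · intro h x hx hx0
    have := h x ⟨x, hx, rfl⟩
    rw [map_pow_mk, map_pow_mk, QuotientAddGroup.eq_zero_iff, QuotientAddGroup.eq_zero_iff] at this
    exact this hx0
  · rintro h _ ⟨x, hx, rfl⟩ hx0
    rw [QuotientAddGroup.mk'_apply, map_pow_mk, QuotientAddGroup.eq_zero_iff] at hx0 ⊢
    exact h x hx hx0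

/-- The subgroups `{x ∈ X | L ^ m x ∈ H}` of the noetherian group `X` form an ascending chain, so
`η` is finite. -/
theorem exists_eta_map_mk_eq_natCast (hLH : H ≤ H.comap L) {X : AddSubgroup G} (hX : X.FG) :
    ∃ n : ℕ, eta (quotientEnd hLH)
      (X.map (QuotientAddGroup.mk' H)) = n := by
  suffices h : ∃ k : ℕ, eta (quotientEnd hLH)
      (X.map (QuotientAddGroup.mk' H)) ≤ k by
    obtain ⟨k, hk⟩ := h
    obtain ⟨n, hn⟩ := ENat.ne_top_iff_exists.1 (ne_top_of_le_ne_top (ENat.natCast_ne_top k) hk)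
    exact ⟨n, hn.symm⟩
  have : Module.Finite ℤ X :=
    Module.Finite.iff_addGroup_fg.2 ((AddGroup.fg_iff_addSubgroup_fg X).2 hX)
  let c : ℕ →o Submodule ℤ X :=
    { toFun := fun m => (AddSubgroup.toIntSubmodule (H.comap (L ^ m))).comap
        X.subtype.toIntLinearMap
      monotone' := monotone_nat_of_le_succ fun m x hx => by
        change (L ^ (m + 1)) x ∈ H
        rw [pow_succ_apply_eq]
        exact hLH hx }
  obtain ⟨k, hk⟩ := monotone_stabilizes_iff_noetherian.2 (inferInstance : IsNoetherian ℤ X) c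
  refine ⟨k, (eta_map_mk_le_natCast_iff hLH X k).2 fun m hm x hx hx0 => ?_⟩
  have h1 : (⟨x, hx⟩ : X) ∈ c (m + 1) := hx0
  rw [← hk (m + 1) (by omega), hk m hm] at h1
  exact h1

/-- If `L` is injective on `H`, then `η` of a subgroup of `X + H` is at most `η` of `X` modulo
`H`. -/
theorem eta_le_of_eta_map_mk_le (hLH : H ≤ H.comap L) (hinj : ∀ x ∈ H, L x = 0 → x = 0)
    {X Y : AddSubgroup G} (hY : Y ≤ X ⊔ H) {n : ℕ}
    (hn : eta (quotientEnd hLH)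
      (X.map (QuotientAddGroup.mk' H)) ≤ n) : eta L Y ≤ n := by
  rw [eta_map_mk_le_natCast_iff] at hn
  rw [eta_le_natCast_iff]
  intro m hm y hy hy0
  obtain ⟨x, hx, d, hd, rfl⟩ := AddSubgroup.mem_sup.1 (hY hy)
  have hd' := pow_apply_mem hLH m hd
  have h1 : (L ^ (m + 1)) x ∈ H := by
    rw [map_add] at hy0
    rw [eq_neg_of_add_eq_zero_left hy0]
    exact H.neg_mem (pow_apply_mem hLH _ hd)
  refine hinj _ ?_ (by rw [← pow_succ_apply_eq, hy0])
  rw [map_add]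
  exact H.add_mem (hn m hm x hx h1) hd'

theorem exists_pow_apply_eq_nsmul (hpre : ∀ h ∈ H, ∃ h' ∈ H, ∃ m : ℕ, 0 < m ∧ L h' = m • h)
    (n : ℕ) : ∀ h ∈ H, ∃ h' ∈ H, ∃ m : ℕ, 0 < m ∧ (L ^ n) h' = m • h := by
  induction n with
  | zero => exact fun h hh => ⟨h, hh, 1, one_pos, by simp⟩
  | succ n ih =>
    intro h hh
    obtain ⟨h₁, hh₁, m, hm, e⟩ := hpre h hh
    obtain ⟨h₂, hh₂, l, hl, e'⟩ := ih h₁ hh₁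
    exact ⟨h₂, hh₂, l * m, Nat.mul_pos hl hm, by
      rw [pow_succ_apply_eq, e', map_nsmul, e, mul_nsmul']⟩

/-- If every element of `H` has a positive multiple with a preimage in `H` and `G ⧸ H` is torsion
free, then for every `x ∈ X` with `L ^ (j + 1) x ∈ H` and `L ^ j x ∉ H` some difference `m • x - h`
with `h ∈ H` is killed by `L ^ (j + 1)`, but not by `L ^ j`. So a lower bound `n` for `η` of `X`
modulo `H` is a lower bound for `η` of each subgroup containing `X` and one suitable `h`. -/
theorem exists_forall_le_eta_of_le_eta_map_mk (hLH : H ≤ H.comap L)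
    (hpre : ∀ h ∈ H, ∃ h' ∈ H, ∃ m : ℕ, 0 < m ∧ L h' = m • h)
    (htf : ∀ (m : ℕ) (x : G), 0 < m → m • x ∈ H → x ∈ H) {X : AddSubgroup G} {n : ℕ}
    (hn : n ≤ eta (quotientEnd hLH)
      (X.map (QuotientAddGroup.mk' H))) :
    ∃ h ∈ H, ∀ Y : AddSubgroup G, X ≤ Y → h ∈ Y → n ≤ eta L Y := by
  cases n with
  | zero => exact ⟨0, H.zero_mem, fun Y _ _ => by simp⟩
  | succ n =>
    -- As `η` exceeds `n`, the induced endomorphism fails to be injective at some `j ≥ n`.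
    have hn' : ¬ eta (quotientEnd hLH)
        (X.map (QuotientAddGroup.mk' H)) ≤ n :=
      not_le.2 (lt_of_lt_of_le (ENat.natCast_lt_natCast.2 n.lt_succ_self) hn)
    rw [eta_map_mk_le_natCast_iff] at hn'
    push Not at hn'
    obtain ⟨j, hj, x, hx, hx1, hx0⟩ := hn'
    obtain ⟨h, hh, m, hm, e⟩ := exists_pow_apply_eq_nsmul hpre (j + 1) _ hx1
    refine ⟨h, hh, fun Y hXY hY => ?_⟩
    rw [Nat.cast_succ, ENat.add_one_le_iff (ENat.natCast_ne_top n), ← not_le, eta_le_natCast_iff]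
    intro hle
    have h1 := hle j hj (m • x - h) (Y.sub_mem (Y.nsmul_mem (hXY hx) m) hY) (by
      rw [map_sub, map_nsmul, e, sub_self])
    rw [map_sub, map_nsmul, sub_eq_zero] at h1
    exact hx0 (htf m _ hm (h1 ▸ pow_apply_mem hLH j hh))

end Eta

/-! ### The group `K₀` -/

section GrothendieckGroup

variable {Λ : Type u} [Ring Λ]

theorem cls_congr {M N : FGModuleCat.{u} Λ} (e : M ≃ₗ[Λ] N) : cls M = cls N := by
  have h0 : cls (FGModuleCat.of Λ PUnit.{u + 1}) = 0 :=
    cls_projective _ (inferInstanceAs (Module.Projective Λ PUnit.{u + 1}))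
  rw [cls_prod (M' := N) (M'' := FGModuleCat.of Λ PUnit.{u + 1})
    (e ≪≫ₗ LinearEquiv.prodUnique.symm),
    h0, add_zero]

/-- The element of `K₀` given by an isomorphism class. -/
def clsIso : IsoClass Λ → KZero Λ :=
  Quotient.lift cls fun _ _ ⟨e⟩ => cls_congr e

theorem clsIso_isoClass (M : FGModuleCat.{u} Λ) : clsIso (isoClass M) = cls M := rfl

theorem HasDecomposition.cls_eq {M : FGModuleCat.{u} Λ} {s : Multiset (IsoClass Λ)}
    (h : HasDecomposition M s) : cls M = (s.map clsIso).sum := by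
  induction h with
  | zero M hM =>
    exact cls_projective M Module.Projective.of_free
  | cons M N M' s hN hf _ ih =>
    obtain ⟨f⟩ := hf
    rw [cls_prod f, ih, Multiset.map_cons, Multiset.sum_cons, clsIso_isoClass]

theorem addSpan_mono {M N : FGModuleCat.{u} Λ} (h : IsSummand M N) : addSpan M ≤ addSpan N :=
  AddSubgroup.closure_mono (Set.image_mono fun _ hX => ⟨hX.1, hX.2.trans h⟩)

theorem cls_mem_addSpan {M N : FGModuleCat.{u} Λ} (hN : IsIndecomposable N) (h : IsSummand N M) :
    cls N ∈ addSpan M :=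
  AddSubgroup.subset_closure ⟨N, ⟨hN, h⟩, rfl⟩

variable {𝒟 : Set (FGModuleCat.{u} Λ)}

theorem mem_of_isSummand (h𝒟 : addClosure 𝒟 = 𝒟) {N D : FGModuleCat.{u} Λ} (hD : D ∈ 𝒟)
    (h : IsSummand N D) : N ∈ 𝒟 := by
  rw [← h𝒟]
  exact ⟨1, fun _ => N, fun _ => ⟨D, hD, h⟩, ⟨(LinearEquiv.funUnique (Fin 1) Λ N).symm⟩⟩

theorem of_prod_mem (h𝒟 : addClosure 𝒟 = 𝒟) {D D' : FGModuleCat.{u} Λ} (hD : D ∈ 𝒟)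
    (hD' : D' ∈ 𝒟) : FGModuleCat.of Λ (D × D') ∈ 𝒟 := by
  rw [← h𝒟]
  refine ⟨2, ![D, D'], fun i => ?_, ⟨?_⟩⟩
  · fin_cases i
    · exact ⟨D, hD, .refl _⟩
    · exact ⟨D', hD', .refl _⟩
  · exact (LinearEquiv.piFinTwo Λ fun i => ((![D, D'] : Fin 2 → FGModuleCat.{u} Λ) i : Type u)).symm

theorem of_punit_mem (h𝒟 : addClosure 𝒟 = 𝒟) : FGModuleCat.of Λ PUnit ∈ 𝒟 := by
  rw [← h𝒟]
  exact ⟨0, Fin.elim0, fun i => i.elim0, ⟨0⟩⟩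

theorem addSpan_le_classSpan (h𝒟 : addClosure 𝒟 = 𝒟) {D : FGModuleCat.{u} Λ} (hD : D ∈ 𝒟) :
    addSpan D ≤ classSpan 𝒟 :=
  AddSubgroup.closure_mono (Set.image_mono fun _ hX => mem_of_isSummand h𝒟 hD hX.2)

variable [IsArtinianRing Λ]

theorem cls_self_mem_addSpan (M : FGModuleCat.{u} Λ) : cls M ∈ addSpan M := by
  rw [(hasDecomposition_decomposition M).cls_eq]
  refine AddSubgroup.multiset_sum_mem _ _ fun x hx => ?_
  obtain ⟨c, hc, rfl⟩ := Multiset.mem_map.1 hx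
  obtain ⟨N, hN, hs, rfl⟩ := (hasDecomposition_decomposition M).exists_of_mem hc
  exact cls_mem_addSpan hN hs

theorem addSpan_fg (M : FGModuleCat.{u} Λ) : (addSpan M).FG := by
  classical
  refine (AddSubgroup.fg_iff _).2 ⟨_, rfl, ?_⟩
  refine (((decomposition M).toFinset.finite_toSet).image clsIso).subset ?_
  rintro _ ⟨N, ⟨hN, hs⟩, rfl⟩
  exact ⟨isoClass N, by simpa using isoClass_mem_decomposition hN hs, rfl⟩

theorem addSpan_prod_le {M P Q : FGModuleCat.{u} Λ} (e : M ≃ₗ[Λ] (P × Q)) :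
    addSpan M ≤ addSpan P ⊔ addSpan Q := by
  refine (AddSubgroup.closure_le _).2 ?_
  rintro _ ⟨N, ⟨hN, hs⟩, rfl⟩
  rcases hN.isSummand_or hs e with h | h
  · exact AddSubgroup.mem_sup_left (cls_mem_addSpan hN h)
  · exact AddSubgroup.mem_sup_right (cls_mem_addSpan hN h)

/-- A class of modules closed under direct sums spans the union of the subgroups `⟨add D⟩`. -/
theorem exists_mem_addSpan (h𝒟 : addClosure 𝒟 = 𝒟) {x : KZero Λ} (hx : x ∈ classSpan 𝒟) :
    ∃ D ∈ 𝒟, x ∈ addSpan D := by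
  induction hx using AddSubgroup.closure_induction with
  | mem x hx =>
    obtain ⟨D, hD, rfl⟩ := hx
    exact ⟨D, hD, cls_self_mem_addSpan D⟩
  | zero => exact ⟨_, of_punit_mem h𝒟, AddSubgroup.zero_mem _⟩
  | add x y _ _ hx hy =>
    obtain ⟨D, hD, hx⟩ := hx
    obtain ⟨D', hD', hy⟩ := hy
    refine ⟨_, of_prod_mem h𝒟 hD hD', AddSubgroup.add_mem _ ?_ ?_⟩
    · exact addSpan_mono (isSummand_left (.refl Λ (D × D'))) hx
    · exact addSpan_mono (isSummand_right (.refl Λ (D × D'))) hy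
  | neg x _ hx =>
    obtain ⟨D, hD, hx⟩ := hx
    exact ⟨D, hD, AddSubgroup.neg_mem _ hx⟩

open Classical in
/-- The homomorphism from `K₀` to the free abelian group on all isomorphism classes that counts, in
a decomposition of a module into indecomposables, the summands whose classes in `K₀` are not in `H`.
It is well defined: the decomposition is additive by Krull–Schmidt, and the direct summands of a
projective module have class `0 ∈ H`. -/
noncomputable def countOutside (H : AddSubgroup (KZero Λ)) : KZero Λ →+ (IsoClass Λ →₀ ℤ) :=
  QuotientAddGroup.lift _ (FreeAbelianGroup.lift fun M : FGModuleCat.{u} Λ =>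
      (((decomposition M).filter fun c => clsIso c ∉ H).map fun c => Finsupp.single c 1).sum) (by
    rw [AddSubgroup.closure_le]
    rintro x (⟨M, M', M'', ⟨e⟩, rfl⟩ | ⟨P, hP, rfl⟩)
    · simp [decomposition_prod e]
    · have h0 : (decomposition P).filter (fun c => clsIso c ∉ H) = 0 := by
        rw [Multiset.filter_eq_nil]
        intro c hc
        obtain ⟨N, -, ⟨B, ⟨e⟩⟩, rfl⟩ := (hasDecomposition_decomposition P).exists_of_mem hc
        have hN : Module.Projective Λ N := Module.Projective.of_split
          (e.symm.toLinearMap ∘ₗ LinearMap.inl Λ N B) (LinearMap.fst Λ N B ∘ₗ e.toLinearMap)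
          (by ext; simp)
        rw [clsIso_isoClass, cls_projective N hN, not_not]
        exact H.zero_mem
      simp [h0])

open Classical in
theorem countOutside_cls (H : AddSubgroup (KZero Λ)) (M : FGModuleCat.{u} Λ) :
    countOutside H (cls M) =
      (((decomposition M).filter fun c => clsIso c ∉ H).map fun c => Finsupp.single c 1).sum :=
  FreeAbelianGroup.lift_apply_of _ _

/-- Up to elements of `H`, an element of `K₀` can be recovered from `countOutside H`. -/
theorem sub_countOutside_mem (H : AddSubgroup (KZero Λ)) (x : KZero Λ) :
    x - (Finsupp.liftAddHom fun c => zmultiplesHom _ (clsIso c)) (countOutside H x) ∈ H := by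
  classical
  set σ : (IsoClass Λ →₀ ℤ) →+ KZero Λ := Finsupp.liftAddHom fun c => zmultiplesHom _ (clsIso c)
  have hcls : ∀ M : FGModuleCat.{u} Λ, cls M - σ (countOutside H (cls M)) ∈ H := by
    intro M
    have h1 : σ (countOutside H (cls M)) =
        (((decomposition M).filter fun c => clsIso c ∉ H).map clsIso).sum := by
      rw [countOutside_cls, map_multiset_sum, Multiset.map_map]
      congr 1
      refine Multiset.map_congr rfl fun c _ => ?_
      simp [σ]
    have h2 : cls M = (((decomposition M).filter fun c => clsIso c ∉ H).map clsIso).sum +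
        (((decomposition M).filter fun c => ¬ clsIso c ∉ H).map clsIso).sum := by
      rw [← Multiset.sum_add, ← Multiset.map_add, Multiset.filter_add_not]
      exact (hasDecomposition_decomposition M).cls_eq
    rw [h1, h2, add_sub_cancel_left]
    refine AddSubgroup.multiset_sum_mem _ _ fun x hx => ?_
    obtain ⟨c, hc, rfl⟩ := Multiset.mem_map.1 hx
    exact not_not.1 (Multiset.mem_filter.1 hc).2
  induction x using QuotientAddGroup.induction_on with
  | H z =>
    induction z using FreeAbelianGroup.induction_on with
    | zero => simp
    | of M => exact hcls M
    | neg M _ =>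
      change -cls M - σ (countOutside H (-cls M)) ∈ H
      rw [map_neg, map_neg, ← neg_sub', H.neg_mem_iff]
      exact hcls M
    | add y z hy hz =>
      rw [QuotientAddGroup.mk_add, map_add, map_add, add_sub_add_comm]
      exact H.add_mem hy hz

/-- The quotient `K₀ / ⟨𝒟⟩` is torsion free when `𝒟 = add 𝒟`: it embeds, by `countOutside`, into a
free abelian group. -/
theorem mem_of_nsmul_mem_classSpan (h𝒟 : addClosure 𝒟 = 𝒟) (m : ℕ) (x : KZero Λ) (hm : 0 < m)
    (h : m • x ∈ classSpan 𝒟) : x ∈ classSpan 𝒟 := by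
  classical
  have h0 : classSpan 𝒟 ≤ (countOutside (classSpan 𝒟)).ker := by
    refine (AddSubgroup.closure_le _).2 ?_
    rintro _ ⟨D, hD, rfl⟩
    change countOutside _ (cls D) = 0
    rw [countOutside_cls, Multiset.filter_eq_nil.2, Multiset.map_zero, Multiset.sum_zero]
    intro c hc
    obtain ⟨N, hN, hs, rfl⟩ := (hasDecomposition_decomposition D).exists_of_mem hc
    rw [not_not]
    exact AddSubgroup.subset_closure ⟨N, mem_of_isSummand h𝒟 hD hs, rfl⟩
  have h1 : m • countOutside (classSpan 𝒟) x = 0 := by rw [← map_nsmul]; exact h0 h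
  have h2 : countOutside (classSpan 𝒟) x = 0 := (nsmul_eq_zero_iff_right hm.ne').1 h1
  simpa [h2] using sub_countOutside_mem (classSpan 𝒟) x

theorem IsZeroITSubcategory.eq_zero_of_omegaBar_eq_zero (h𝒟 : IsZeroITSubcategory 𝒟) :
    ∀ x ∈ classSpan 𝒟, omegaBar Λ x = 0 → x = 0 := by
  intro x hx hx0
  obtain ⟨D, hD, hxD⟩ := exists_mem_addSpan h𝒟.addClosure_eq hx
  have hphi : eta (omegaBar Λ) (addSpan D) ≤ (0 : ℕ) :=
    (le_iSup₂ (f := fun M (_ : M ∈ 𝒟) => phi M) D hD).trans h𝒟.phiDim_eq_zero.le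
  exact (eta_le_natCast_iff _ _ 0).1 hphi 0 le_rfl x hxD (by simpa using hx0)

theorem IsZeroITSubcategoryWithPreimages.exists_omegaBar_eq_nsmul
    (h𝒟 : IsZeroITSubcategoryWithPreimages 𝒟) :
    ∀ h ∈ classSpan 𝒟, ∃ h' ∈ classSpan 𝒟, ∃ m : ℕ, 0 < m ∧ omegaBar Λ h' = m • h := by
  intro h hh
  induction hh using AddSubgroup.closure_induction with
  | mem x hx =>
    obtain ⟨D, hD, rfl⟩ := hx
    obtain ⟨D₁, hD₁, D₂, hD₂, m, hm, e⟩ := h𝒟.preimages D hD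
    exact ⟨_, AddSubgroup.sub_mem _ (AddSubgroup.subset_closure ⟨D₁, hD₁, rfl⟩)
      (AddSubgroup.subset_closure ⟨D₂, hD₂, rfl⟩), m, hm, e⟩
  | zero => exact ⟨0, AddSubgroup.zero_mem _, 1, one_pos, by simp⟩
  | add x y _ _ hx hy =>
    obtain ⟨x', hx', m, hm, e⟩ := hx
    obtain ⟨y', hy', l, hl, e'⟩ := hy
    refine ⟨l • x' + m • y', AddSubgroup.add_mem _ (AddSubgroup.nsmul_mem _ hx' _)
      (AddSubgroup.nsmul_mem _ hy' _), l * m, Nat.mul_pos hl hm, ?_⟩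
    rw [map_add, map_nsmul, map_nsmul, e, e', smul_add, smul_smul, smul_smul, mul_comm l m]
  | neg x _ hx =>
    obtain ⟨x', hx', m, hm, e⟩ := hx
    exact ⟨-x', AddSubgroup.neg_mem _ hx', m, hm, by rw [map_neg, e, smul_neg]⟩

end GrothendieckGroup
end IgusaTodorov

open IgusaTodorov in
theorem mainTheorem1 (A : Type u) [Ring A] [IgusaTodorov.IsArtinAlgebra A]
    (𝒟 : Set (FGModuleCat.{u} Aᵐᵒᵖ)) (h𝒟 : IgusaTodorov.IsZeroITSubcategoryWithPreimages 𝒟)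
    (M : FGModuleCat.{u} Aᵐᵒᵖ) :
    ∃ D ∈ 𝒟, IgusaTodorov.phi (FGModuleCat.of Aᵐᵒᵖ (M × D)) =
      IgusaTodorov.relPhi 𝒟 h𝒟.syzygyInvariant M := by
  have hadd := h𝒟.addClosure_eq
  have hLH := classSpan_le_comap h𝒟.syzygyInvariant
  obtain ⟨n, hn⟩ := exists_eta_map_mk_eq_natCast hLH (addSpan_fg M)
  obtain ⟨h, hh, hY⟩ := exists_forall_le_eta_of_le_eta_map_mk hLH h𝒟.exists_omegaBar_eq_nsmul
    (mem_of_nsmul_mem_classSpan hadd) hn.ge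
  obtain ⟨D, hD, hhD⟩ := exists_mem_addSpan hadd hh
  have e : FGModuleCat.of Aᵐᵒᵖ (M × D) ≃ₗ[Aᵐᵒᵖ] (M × D) := .refl _ _
  refine ⟨D, hD, Eq.trans (le_antisymm ?_ ?_) hn.symm⟩
  · refine eta_le_of_eta_map_mk_le hLH h𝒟.eq_zero_of_omegaBar_eq_zero ?_ hn.le
    exact (addSpan_prod_le e).trans (sup_le_sup_left (addSpan_le_classSpan hadd hD) _)
  · exact hY _ (addSpan_mono (isSummand_left e)) (addSpan_mono (isSummand_right e) hhD)
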